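/- A hybrid time domain is a set $E\subset\mathbb R_{\ge0}\times\mathbb Z_{\ge0}$ that is a nonempty union of a finite or infinite sequence of intervals $[t_j,t_{j+1}]\times\{j\}$, $0=t_0\le t_1\le\cdots$, the last of which, if there is one, may be of the form $[t_j,T)\times\{j\}$ with $T\le\infty$. Write $I^j=\{t:(t,j)\in E\}$. For $(t_o,j_o)\in E$ and $K>0$, let $E_{t_o,j_o,K}=\bigcup_{i=j_o}^{m}[t_i,t_{i+1}]\times\{i\}$ (with $t_{j_o}=t_o$) be the shortest hybrid time domain contained in $E$ that starts at $(t_o,j_o)$ and has length $(t_{m+1}-t_o)+(m-j_o)\ge K$, and put $$\int_{E_{t_o,j_o,K}}\Phi(s,i)\,d(s,i):=\sum_{i=j_o}^{m}\int_{t_i}^{t_{i+1}}\Phi(s,i)\,ds+\sum_{i=j_o}^{m-1}\Phi(t_{i+1},i).$$ Let $n\ge 0$, $\gamma>0$, $\bar\psi>0$, let $\psi:E\to\mathbb R^{n}$ satisfy $|\psi(t,j)|\le\bar\psi$ on $E$, and let $$A(t,j)=\gamma\,\psi(t,j)\psi(t,j)^\top,\qquad B(t,j)=\frac{\gamma\,\psi(t,j)\psi(t,j)^\top}{1+\gamma|\psi(t,j)|^2}.$$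 Consider the hybrid gradient-descent error dynamics $$\dot{\tilde\theta}=-A(t,j)\tilde\theta\ \ (t\in\operatorname{int}I^j),\qquad \tilde\theta^+=[I-B(t,j)]\tilde\theta\ \ ((t,j),(t,j+1)\in E).$$ Its solutions from $(t_o,j_o)\in E$ are the functions $\tilde\theta:\operatorname{dom}\tilde\theta\to\mathbb R^n$, where $\operatorname{dom}\tilde\theta\subset E$ is a hybrid time domain starting at $(t_o,j_o)$, that are locally absolutely continuous in $t$ for each $j$, satisfy the differential equation for almost every $t$ in the interior of $\{t:(t,j)\in\operatorname{dom}\tilde\theta\}$, and satisfy the jump equation whenever $(t,j),(t,j+1)\in\operatorname{dom}\tilde\theta$. Assume that $(A,B)$ is hybrid persistently exciting (HPE) with constants $K,\mu>0$: for every $(t_o,j_o)\in E$ the set $E_{t_o,j_o,K}$ exists, the integral below exists, and $$\int_{E_{t_o,j_o,K}}\Phi_{AB}(s,i)\,d(s,i)\ \ge\ \mu I,\qquad \Phi_{AB}(t,j)=\begin{cases}A(t,j)& t\in\operatorname{int}I^j,\\ B(t,j)&\text{otherwise.}\end{cases}$$ Then the origin $\tilde\theta=0$ is uniformly exponentially stable: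 there are $\kappa,\lambda>0$ such that for every $(t_o,j_o)\in E$ and every solution $\tilde\theta$ starting at $(t_o,j_o)$, $$|\tilde\theta(t,j)|\le\kappa\,|\tilde\theta(t_o,j_o)|\,e^{-\lambda(t+j-t_o-j_o)}\qquad\forall (t,j)\in\operatorname{dom}\tilde\theta .$$ Moreover, $\kappa$ and $\lambda$ can be computed from $\bar\psi,\mu,K$ (and the fixed gain $\gamma$): with $\bar A=\gamma\bar\psi^2$, the bound holds with $$\kappa=c\,e^{1/2},\quad \lambda=\frac1{2c^2},\quad c^2=(K+1)\Big(\frac1{\mu_o}+1\Big),\quad \mu_o=\frac{\rho\mu}{1+\rho},\quad \rho=\frac{1}{(K+2)^2\big[\tfrac{\bar A}{2}(K+1)+1+\bar A(\bar A+2)(K+1)(K+2)\big]}.$$ -/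

import Mathlib

open MeasureTheory

noncomputable section

namespace HybridGradient

/-! ### Hybrid time domains -/

/-- The compact set `⋃_{j = j₀}^{J} [τ j, τ (j+1)] × {j}`. -/
def compactDomain (j₀ J : ℕ) (τ : ℕ → ℝ) : Set (ℝ × ℕ) :=
  {p | p.2 ∈ Set.Icc j₀ J ∧ p.1 ∈ Set.Icc (τ p.2) (τ (p.2 + 1))}

/-- `E` is a (nonempty) hybrid time domain that starts at the hybrid time `(t₀, j₀)`. The clause
`ordered` says that later jump indices come with later times. It is part of the usual notion (`E` is
a finite or infinite union of consecutive intervals `[t_j, t_{j+1}] × {j}`, the last of which may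
be half-open); it excludes branching sets such as `[0,2] × {0} ∪ {1} × {1}`, which satisfy the
truncation clause. -/
structure IsHybridTimeDomainFrom (t₀ : ℝ) (j₀ : ℕ) (E : Set (ℝ × ℕ)) : Prop where
  start_mem : (t₀, j₀) ∈ E
  start_le : ∀ p ∈ E, t₀ ≤ p.1 ∧ j₀ ≤ p.2
  truncation : ∀ T J, (T, J) ∈ E → ∃ τ : ℕ → ℝ, τ j₀ = t₀ ∧ τ (J + 1) = T ∧
    (∀ i ∈ Set.Icc j₀ J, τ i ≤ τ (i + 1)) ∧
    E ∩ (Set.Icc t₀ T ×ˢ Set.Icc j₀ J) = compactDomain j₀ J τ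
  ordered : ∀ p ∈ E, ∀ q ∈ E, p.2 < q.2 → p.1 ≤ q.1

/-- Hybrid time domains, subsets of `ℝ≥0 × ℤ≥0` that start at `(0, 0)`. -/
def IsHybridTimeDomain (E : Set (ℝ × ℕ)) : Prop :=
  IsHybridTimeDomainFrom 0 0 E

/-- `I^j = {t : (t, j) ∈ E}`. -/
def flowInterval (E : Set (ℝ × ℕ)) (j : ℕ) : Set ℝ :=
  {t | (t, j) ∈ E}

/-! ### The hybrid integral -/

/-- `compactDomain j₀ m τ` is the shortest hybrid time domain that starts at `(t₀, j₀)`, is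
contained in `E`, and has length at least `K`; its end point is `(τ (m + 1), m)`. -/
structure IsWindow (E : Set (ℝ × ℕ)) (t₀ : ℝ) (j₀ : ℕ) (K : ℝ) (m : ℕ) (τ : ℕ → ℝ) : Prop where
  index_le : j₀ ≤ m
  start : τ j₀ = t₀
  mono : ∀ i ∈ Set.Icc j₀ m, τ i ≤ τ (i + 1)
  truncation : E ∩ (Set.Icc t₀ (τ (m + 1)) ×ˢ Set.Icc j₀ m) = compactDomain j₀ m τ
  long : K ≤ (τ (m + 1) - t₀) + ((m : ℝ) - (j₀ : ℝ))
  shortest : ∀ s i, (s, i) ∈ E → t₀ ≤ s → j₀ ≤ i → K ≤ (s - t₀) + ((i : ℝ) - (j₀ : ℝ)) →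
    τ (m + 1) + (m : ℝ) ≤ s + (i : ℝ)

/-- The hybrid integral of `f` over `⋃_{i = j₀}^{m} [τ i, τ (i+1)] × {i}`. -/
def hybridIntegral (j₀ m : ℕ) (τ : ℕ → ℝ) (f : ℝ → ℕ → ℝ) : ℝ :=
  (∑ i ∈ Finset.Icc j₀ m, ∫ s in (τ i)..(τ (i + 1)), f s i)
    + ∑ i ∈ Finset.Ico j₀ m, f (τ (i + 1)) i

/-! ### Hybrid persistency of excitation -/

open Classical in
/-- `Φ_{AB}`: equal to `A` at interior times of `I^j`, and to `B` otherwise. -/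
def excitation {n : ℕ} (E : Set (ℝ × ℕ)) (A B : ℝ → ℕ → Matrix (Fin n) (Fin n) ℝ)
    (t : ℝ) (j : ℕ) : Matrix (Fin n) (Fin n) ℝ :=
  if t ∈ interior (flowInterval E j) then A t j else B t j

/-- The pair `(A, B)` with domain `E` is HPE with constants `K` and `μ`: from every `(t₀, j₀) ∈ E`
there is a window of length at least `K` in `E`, the (entrywise) integral of `Φ_{AB}` over the
shortest such window exists, and it is at least `μ I` in the order of symmetric matrices. -/
def IsHPEWith {n : ℕ} (E : Set (ℝ × ℕ)) (A B : ℝ → ℕ → Matrix (Fin n) (Fin n) ℝ)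
    (K μ : ℝ) : Prop :=
  0 < K ∧ 0 < μ ∧ ∀ t₀ j₀, (t₀, j₀) ∈ E → ∃ (m : ℕ) (τ : ℕ → ℝ), IsWindow E t₀ j₀ K m τ ∧
    (∀ i ∈ Set.Icc j₀ m, ∀ a b,
      IntervalIntegrable (fun s => excitation E A B s i a b) volume (τ i) (τ (i + 1))) ∧
    (Matrix.of (fun a b => hybridIntegral j₀ m τ (fun s i => excitation E A B s i a b))
      - μ • (1 : Matrix (Fin n) (Fin n) ℝ)).PosSemidef

/-! ### Solutions and uniform exponential stability -/

/-- `ζ` with domain `S` is a solution, starting at `(t₀, j₀)`, of the linear hybrid system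
`ζ' = -A(t,j) ζ` for `t ∈ int I^j`, `ζ⁺ = (I - B(t,j)) ζ` when `(t,j), (t,j+1) ∈ E`,
where `E` is the common domain of `A` and `B`. Values of `ζ` outside `S` are irrelevant. -/
structure IsSolution {n : ℕ} (E : Set (ℝ × ℕ)) (A B : ℝ → ℕ → Matrix (Fin n) (Fin n) ℝ)
    (t₀ : ℝ) (j₀ : ℕ) (S : Set (ℝ × ℕ)) (ζ : ℝ → ℕ → EuclideanSpace ℝ (Fin n)) : Prop where
  domain : IsHybridTimeDomainFrom t₀ j₀ S
  subset : S ⊆ E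
  locallyAC : ∀ j, ∀ a ∈ flowInterval S j, ∀ b ∈ flowInterval S j,
    AbsolutelyContinuousOnInterval (fun t => ζ t j) a b
  flow : ∀ j, ∀ᵐ t, t ∈ interior (flowInterval S j) →
    HasDerivAt (fun s => ζ s j) (-(Matrix.toEuclideanLin (A t j) (ζ t j))) t
  jump : ∀ t j, (t, j) ∈ S → (t, j + 1) ∈ S →
    ζ t (j + 1) = Matrix.toEuclideanLin (1 - B t j) (ζ t j)

/-- The origin is uniformly exponentially stable with overshoot `κ` and rate `r`, both independent
of the solution and of its initial hybrid time. -/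
def IsUESWith {n : ℕ} (E : Set (ℝ × ℕ)) (A B : ℝ → ℕ → Matrix (Fin n) (Fin n) ℝ)
    (κ r : ℝ) : Prop :=
  0 < κ ∧ 0 < r ∧ ∀ t₀ j₀, (t₀, j₀) ∈ E → ∀ S ζ, IsSolution E A B t₀ j₀ S ζ →
    ∀ t j, (t, j) ∈ S →
      ‖ζ t j‖ ≤ κ * ‖ζ t₀ j₀‖ * Real.exp (-r * (t + (j : ℝ) - t₀ - (j₀ : ℝ)))

/-- The origin is uniformly exponentially stable. -/
def IsUES {n : ℕ} (E : Set (ℝ × ℕ)) (A B : ℝ → ℕ → Matrix (Fin n) (Fin n) ℝ) : Prop :=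
  ∃ κ r : ℝ, IsUESWith E A B κ r

/-! ### The hybrid gradient-descent error dynamics -/

/-- `A = γ ψ ψᵀ`. -/
def gradA {n : ℕ} (γ : ℝ) (ψ : ℝ → ℕ → EuclideanSpace ℝ (Fin n)) (t : ℝ) (j : ℕ) :
    Matrix (Fin n) (Fin n) ℝ :=
  γ • Matrix.vecMulVec (ψ t j).ofLp (ψ t j).ofLp

/-- `B = γ ψ ψᵀ / (1 + γ |ψ|²)`. -/
def gradB {n : ℕ} (γ : ℝ) (ψ : ℝ → ℕ → EuclideanSpace ℝ (Fin n)) (t : ℝ) (j : ℕ) :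
    Matrix (Fin n) (Fin n) ℝ :=
  (γ / (1 + γ * ‖ψ t j‖ ^ 2)) • Matrix.vecMulVec (ψ t j).ofLp (ψ t j).ofLp

/-! ### The explicit stability constants

Here `a` stands for `γ ψ̄²`, the bound on `|A|`. -/

/-- `ρ`. -/
def rhoConst (a K : ℝ) : ℝ :=
  1 / ((K + 2) ^ 2 * (a / 2 * (K + 1) + 1 + a * (a + 2) * (K + 1) * (K + 2)))

/-- `μ₀ = ρ μ / (1 + ρ)`. -/
def muConst (a μ K : ℝ) : ℝ :=
  rhoConst a K * μ / (1 + rhoConst a K)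

/-- `c² = (K + 1) (1 / μ₀ + 1)`. -/
def cSqConst (a μ K : ℝ) : ℝ :=
  (K + 1) * (1 / muConst a μ K + 1)

/-- `κ = c e^{1/2}`. -/
def kappa (γ ψbar μ K : ℝ) : ℝ :=
  Real.sqrt (cSqConst (γ * ψbar ^ 2) μ K) * Real.exp (1 / 2)

/-- The rate `1 / (2 c²)`. -/
def rate (γ ψbar μ K : ℝ) : ℝ :=
  1 / (2 * cSqConst (γ * ψbar ^ 2) μ K)

end HybridGradient

end

namespace HybridGradient

/-! The Lyapunov function is V = |θ|². Flows dissipate it at rate 2γ⟨ψ,θ⟩², and a jump with gain b =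
γ/(1+γ|ψ|²) lowers it by at least b⟨ψ,θ⟩², because b|ψ|² ≤ 1. This dissipation sees only the
component of θ along ψ at the current time, whereas excitation bounds the integrated quadratic form
from below at a fixed vector.

The two are compared by freezing θ at the start of a window. Let α = γψ̄², let the window have
elapsed time T and N jumps, put q = αT + N, and let D be the drop of V over it. A solution that
loses little V moves little: its displacement squared is at most qD (`IsSolution.norm_sub_sq_le`).
Replacing the frozen vector by the current state therefore costs only a multiple of D, and
`IsSolution.excitation_le_decrease` gives μV ≤ (1+q)²D.

Minimality of the window gives T + N ≤ K + 1, so V contracts by 1 - μ₀ on each window. Chaining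
windows in `IsSolution.norm_sq_le_exp` yields exponential decay. -/

theorem _root_.AbsolutelyContinuousOnInterval.norm_sq {F : Type*} [SeminormedAddCommGroup F]
    {x : ℝ → F} {a b : ℝ}
    (hx : AbsolutelyContinuousOnInterval x a b) :
    AbsolutelyContinuousOnInterval (fun t => ‖x t‖ ^ 2) a b := by
  have h : AbsolutelyContinuousOnInterval (fun t => ‖x t‖) a b :=
    squeeze_zero (fun t => Finset.sum_nonneg fun i _ => dist_nonneg)
      (fun t => Finset.sum_le_sum fun i _ =>
        (dist_norm_norm_le _ _).trans_eq (dist_eq_norm _ _).symm) hx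
  simpa only [pow_two] using h.fun_mul h

theorem jumpGain_mul_sq_le {γ : ℝ} (hγ : 0 < γ) (r : ℝ) : γ / (1 + γ * r ^ 2) * r ^ 2 ≤ 1 := by
  rw [div_mul_eq_mul_div, div_le_one (by positivity)]
  linarith

/-! ### Energy estimates for one flow interval and one jump -/

section InnerProductSpace

variable {F : Type*} [NormedAddCommGroup F] [InnerProductSpace ℝ F]

theorem _root_.AbsolutelyContinuousOnInterval.inner_const {x : ℝ → F} {a b : ℝ}
    (hx : AbsolutelyContinuousOnInterval x a b) (w : F) :
    AbsolutelyContinuousOnInterval (fun t => inner ℝ w (x t)) a b := by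
  have h := Filter.Tendsto.const_mul ‖w‖ hx
  rw [mul_zero] at h
  refine squeeze_zero (fun t => Finset.sum_nonneg fun i _ => dist_nonneg) (fun t => ?_) h
  rw [Finset.mul_sum]
  refine Finset.sum_le_sum fun i _ => ?_
  rw [Real.dist_eq, ← inner_sub_right, dist_eq_norm]
  exact abs_real_inner_le_norm _ _

theorem intervalIntegral_mono_ae_Ioo {f g : ℝ → ℝ} {a b : ℝ} (hab : a ≤ b)
    (hf : IntervalIntegrable f volume a b) (hg : IntervalIntegrable g volume a b)
    (h : ∀ᵐ t, t ∈ Set.Ioo a b → f t ≤ g t) :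
    ∫ t in a..b, f t ≤ ∫ t in a..b, g t := by
  simp only [intervalIntegral.integral_of_le hab, integral_Ioc_eq_integral_Ioo]
  exact setIntegral_mono_on_ae (hf.1.mono Set.Ioo_subset_Ioc_self le_rfl)
    (hg.1.mono Set.Ioo_subset_Ioc_self le_rfl) measurableSet_Ioo h

/-- An absolutely continuous real function whose derivative is a.e. nonpositive does not
increase. -/
theorem _root_.AbsolutelyContinuousOnInterval.le_of_ae_hasDerivAt_nonpos {f f' : ℝ → ℝ} {a b : ℝ}
    (hab : a ≤ b) (hf : AbsolutelyContinuousOnInterval f a b)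
    (hd : ∀ᵐ t, t ∈ Set.Ioo a b → HasDerivAt f (f' t) t) (hf' : ∀ t ∈ Set.Ioo a b, f' t ≤ 0) :
    f b ≤ f a := by
  have h1 : ∫ t in a..b, deriv f t ≤ ∫ t in a..b, (0 : ℝ) := by
    refine intervalIntegral_mono_ae_Ioo hab hf.intervalIntegrable_deriv
      intervalIntegrable_const ?_
    filter_upwards [hd] with t ht hm
    exact (ht hm).deriv.trans_le (hf' t hm)
  rw [hf.integral_deriv_eq_sub] at h1
  simpa using h1

/-- The flow of the gradient dynamics on `[a, b]`, with a.e. derivative `-γ ⟪ψ, x⟫ ψ`. -/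
structure IsGradientFlow (γ : ℝ) (ψ x : ℝ → F) (a b : ℝ) : Prop where
  le : a ≤ b
  ac : AbsolutelyContinuousOnInterval x a b
  hasDerivAt : ∀ᵐ t, t ∈ Set.Ioo a b → HasDerivAt x (-((γ * inner ℝ (ψ t) (x t)) • ψ t)) t

theorem IsGradientFlow.hasDerivAt_norm_sq {γ : ℝ} {ψ x : ℝ → F} {a b : ℝ}
    (h : IsGradientFlow γ ψ x a b) :
    ∀ᵐ t, t ∈ Set.Ioo a b →
      HasDerivAt (fun s => ‖x s‖ ^ 2) (-(2 * γ * inner ℝ (ψ t) (x t) ^ 2)) t := by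
  filter_upwards [h.hasDerivAt] with t ht hm
  convert (ht hm).norm_sq using 1
  rw [inner_neg_right, inner_smul_right, real_inner_comm]
  ring

theorem mul_inner_sq_le {γ a : ℝ} (hγ : 0 ≤ γ) {p : F} (hp : γ * ‖p‖ ^ 2 ≤ a) (w : F) :
    γ * inner ℝ p w ^ 2 ≤ a * ‖w‖ ^ 2 := by
  have h : inner ℝ p w ^ 2 ≤ ‖p‖ ^ 2 * ‖w‖ ^ 2 := by
    rw [← mul_pow]
    exact sq_le_sq' (neg_le_of_abs_le (abs_real_inner_le_norm _ _))
      (le_of_abs_le (abs_real_inner_le_norm _ _))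
  calc γ * inner ℝ p w ^ 2 ≤ γ * (‖p‖ ^ 2 * ‖w‖ ^ 2) := by gcongr
    _ = γ * ‖p‖ ^ 2 * ‖w‖ ^ 2 := by ring
    _ ≤ a * ‖w‖ ^ 2 := by gcongr

/-- Cauchy–Schwarz for the displacement, with the optimisation over `c` postponed. In this form it
is the monotonicity of a scalar function, so it chains across flows and jumps; `c = 0` gives
monotonicity of the norm. -/
theorem IsGradientFlow.inner_sub_le {γ α : ℝ} (hγ : 0 ≤ γ) {ψ x : ℝ → F} {a b : ℝ}
    (h : IsGradientFlow γ ψ x a b) (hψ : ∀ t ∈ Set.Ioo a b, γ * ‖ψ t‖ ^ 2 ≤ α) (w : F) (c : ℝ) :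
    2 * c * inner ℝ w (x a - x b) ≤
      c ^ 2 * ‖w‖ ^ 2 * (α * (b - a)) + (‖x a‖ ^ 2 - ‖x b‖ ^ 2) := by
  have hid : AbsolutelyContinuousOnInterval (fun t : ℝ => t) a b :=
    LipschitzOnWith.absolutelyContinuousOnInterval (K := 1) (LipschitzWith.id.lipschitzOnWith)
  have hac := ((h.ac.norm_sq).fun_sub ((h.ac.inner_const w).const_mul (2 * c))).fun_sub
    (hid.const_mul (c ^ 2 * ‖w‖ ^ 2 * α))
  have key := hac.le_of_ae_hasDerivAt_nonpos h.le
    (f' := fun t => -(2 * γ * inner ℝ (ψ t) (x t) ^ 2)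
      - 2 * c * (-(γ * inner ℝ (ψ t) (x t) * inner ℝ w (ψ t))) - c ^ 2 * ‖w‖ ^ 2 * α * 1) ?_ ?_
  · simp only [inner_sub_right]
    linarith
  · filter_upwards [h.hasDerivAt, h.hasDerivAt_norm_sq] with t h1 h2 hm
    have h3 : HasDerivAt (fun s => inner ℝ w (x s))
        (-(γ * inner ℝ (ψ t) (x t) * inner ℝ w (ψ t))) t := by
      simpa [inner_neg_right, inner_smul_right] using (hasDerivAt_const t w).inner ℝ (h1 hm)
    exact ((h2 hm).sub (h3.const_mul _)).sub ((hasDerivAt_id t).const_mul _)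
  -- Completing the square in ⟨ψ,x⟩ - c⟨ψ,w⟩ absorbs the cross term using half of the dissipation.
  · intro t ht
    have h1 := mul_inner_sq_le hγ (hψ t ht) w
    have h2 : c ^ 2 * (γ * inner ℝ (ψ t) w ^ 2) ≤ c ^ 2 * (α * ‖w‖ ^ 2) := by gcongr
    have h3 : 0 ≤ γ * (inner ℝ (ψ t) (x t) - c * inner ℝ (ψ t) w) ^ 2 := by positivity
    have h4 : 0 ≤ γ * inner ℝ (ψ t) (x t) ^ 2 := by positivity
    simp only [real_inner_comm (ψ t) w] at *
    nlinarith

/-- Splitting a quadratic form at a reference vector `v`. -/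
theorem mul_inner_sq_le_split {γ α q D : ℝ} (hγ : 0 ≤ γ) (hq : 0 < q) (hα : 0 ≤ α) {p : F}
    (hp : γ * ‖p‖ ^ 2 ≤ α) {v y : F} (hvy : ‖v - y‖ ^ 2 ≤ q * D) :
    γ * inner ℝ p v ^ 2 ≤ (1 + q) * (γ * inner ℝ p y ^ 2 + α * D) := by
  have h1 : γ * inner ℝ p (v - y) ^ 2 ≤ q * (α * D) := by
    refine (mul_inner_sq_le hγ hp (v - y)).trans ?_
    calc α * ‖v - y‖ ^ 2 ≤ α * (q * D) := by gcongr
      _ = _ := by ring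
  rw [inner_sub_right] at h1
  set s := inner ℝ p v
  set r := inner ℝ p y
  -- Young's inequality with weight `q`: the factor (1 + 1/q) on the error, times its bound `q * D`,
  -- is again (1 + q) * D.
  have h2 : 0 ≤ γ * (s - r - q * r) ^ 2 := by positivity
  have h3 : q * (γ * s ^ 2) ≤ q * ((1 + q) * (γ * r ^ 2 + α * D)) := by nlinarith
  exact le_of_mul_le_mul_left h3 hq

theorem IsGradientFlow.integral_inner_sq_le {γ α q D : ℝ} (hγ : 0 ≤ γ) (hq : 0 < q) (hα : 0 ≤ α)
    {ψ x : ℝ → F} {a b : ℝ} (h : IsGradientFlow γ ψ x a b)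
    (hψ : ∀ t ∈ Set.Ioo a b, γ * ‖ψ t‖ ^ 2 ≤ α) {v : F}
    (hv : ∀ t ∈ Set.Ioo a b, ‖v - x t‖ ^ 2 ≤ q * D) {f : ℝ → ℝ}
    (hf : ∀ t ∈ Set.Ioo a b, f t = γ * inner ℝ (ψ t) v ^ 2)
    (hfi : IntervalIntegrable f volume a b) :
    ∫ t in a..b, f t ≤ (1 + q) * ((‖x a‖ ^ 2 - ‖x b‖ ^ 2) + α * D * (b - a)) := by
  have hac := h.ac.norm_sq
  have hmono : ‖x b‖ ^ 2 ≤ ‖x a‖ ^ 2 := by simpa using h.inner_sub_le hγ hψ 0 0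
  -- The dissipation is written as -V'/2, which is integrable by absolute continuity, as `ψ` is not
  -- assumed measurable. The factor 1/2 is dropped at the end, so that flows and jumps obey the same
  -- bound.
  have h1 : ∫ t in a..b, f t ≤
      ∫ t in a..b, (1 + q) * (-(1 / 2) * deriv (fun s => ‖x s‖ ^ 2) t + α * D) := by
    refine intervalIntegral_mono_ae_Ioo h.le hfi
      (((hac.intervalIntegrable_deriv.const_mul _).add intervalIntegrable_const).const_mul _) ?_
    filter_upwards [h.hasDerivAt_norm_sq] with t ht hm
    rw [hf t hm, (ht hm).deriv]
    convert mul_inner_sq_le_split hγ hq hα (hψ t hm) (hv t hm) using 2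
    ring
  refine h1.trans ?_
  rw [intervalIntegral.integral_const_mul, intervalIntegral.integral_add
    (hac.intervalIntegrable_deriv.const_mul _) intervalIntegrable_const,
    intervalIntegral.integral_const_mul, hac.integral_deriv_eq_sub,
    intervalIntegral.integral_const, smul_eq_mul]
  have : 0 ≤ 1 + q := by positivity
  refine mul_le_mul_of_nonneg_left ?_ this
  linarith

/-- The exact drop is b⟨p,y⟩²(2 - b|p|²), and the normalised gain makes the last factor at least 1.
-/
theorem jump_norm_sq_le {b : ℝ} (hb : 0 ≤ b) {p : F} (hp : b * ‖p‖ ^ 2 ≤ 1) (y : F) :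
    b * inner ℝ p y ^ 2 ≤ ‖y‖ ^ 2 - ‖y - (b * inner ℝ p y) • p‖ ^ 2 := by
  rw [norm_sub_sq_real, inner_smul_right, norm_smul, Real.norm_eq_abs, mul_pow, sq_abs,
    real_inner_comm p y]
  have h : 0 ≤ (b * inner ℝ p y ^ 2) * (1 - b * ‖p‖ ^ 2) := by
    have : 0 ≤ 1 - b * ‖p‖ ^ 2 := by linarith
    positivity
  nlinarith

/-- Jump counterpart of `IsGradientFlow.inner_sub_le`: one jump costs 1 where a flow costs `α * (b -
a)`. -/
theorem jump_inner_sub_le {b : ℝ} (hb : 0 ≤ b) {p : F} (hp : b * ‖p‖ ^ 2 ≤ 1) (y w : F) (c : ℝ) :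
    2 * c * inner ℝ w (y - (y - (b * inner ℝ p y) • p)) ≤
      c ^ 2 * ‖w‖ ^ 2 + (‖y‖ ^ 2 - ‖y - (b * inner ℝ p y) • p‖ ^ 2) := by
  have h1 := jump_norm_sq_le hb hp y
  have h2 := mul_inner_sq_le hb hp w
  have h3 : c ^ 2 * (b * inner ℝ p w ^ 2) ≤ c ^ 2 * (1 * ‖w‖ ^ 2) := by gcongr
  have h4 : 0 ≤ b * (inner ℝ p y - c * inner ℝ p w) ^ 2 := by positivity
  rw [sub_sub_cancel, inner_smul_right, real_inner_comm p w]
  nlinarith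

end InnerProductSpace

/-! ### Geometry of hybrid time domains and windows -/

section TimeDomain

variable {E S : Set (ℝ × ℕ)} {t₀ t t' K : ℝ} {j₀ j j' m : ℕ} {τ : ℕ → ℝ}

theorem mem_compactDomain {s : ℝ} {i : ℕ} :
    (s, i) ∈ compactDomain j₀ m τ ↔ (j₀ ≤ i ∧ i ≤ m) ∧ τ i ≤ s ∧ s ≤ τ (i + 1) := Iff.rfl

/-- A function that increases neither along flows nor at jumps does not increase. -/
theorem IsHybridTimeDomainFrom.le_of_antitone (hS : IsHybridTimeDomainFrom t₀ j₀ S)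
    {G : ℝ → ℕ → ℝ}
    (hflow : ∀ i a b, (∀ s ∈ Set.Icc a b, (s, i) ∈ S) → a ≤ b → G b i ≤ G a i)
    (hjump : ∀ s i, (s, i) ∈ S → (s, i + 1) ∈ S → G s (i + 1) ≤ G s i)
    (hp : (t, j) ∈ S) (hq : (t', j') ∈ S) (ht : t ≤ t') (hj : j ≤ j') : G t' j' ≤ G t j := by
  obtain ⟨τ, hτ₀, hτ₁, hmono, htr⟩ := hS.truncation t' j' hq
  have hsub : ∀ {s i}, (s, i) ∈ compactDomain j₀ j' τ → (s, i) ∈ S := fun h =>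
    (htr.symm.subset h).1
  have hp' : (t, j) ∈ compactDomain j₀ j' τ :=
    htr.subset ⟨hp, ⟨(hS.start_le _ hp).1, ht⟩, (hS.start_le _ hp).2, hj⟩
  obtain ⟨⟨hj₀, -⟩, h1, h2⟩ := mem_compactDomain.1 hp'
  have key : ∀ i, j ≤ i → i ≤ j' → G (τ (i + 1)) i ≤ G t j := by
    intro i hi
    induction i, hi using Nat.le_induction with
    | base =>
      intro _
      exact hflow j t _ (fun s hs => hsub (mem_compactDomain.2 ⟨⟨hj₀, hj⟩, h1.trans hs.1, hs.2⟩)) h2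
    | succ i hi ih =>
      intro hij
      have m1 := hmono i ⟨hj₀.trans hi, by omega⟩
      have m2 := hmono (i + 1) ⟨by omega, hij⟩
      refine (hflow (i + 1) _ _ (fun s hs => hsub (mem_compactDomain.2
        ⟨⟨by omega, hij⟩, hs.1, hs.2⟩)) m2).trans ((hjump _ _ ?_ ?_).trans (ih (by omega)))
      · exact hsub (mem_compactDomain.2 ⟨⟨by omega, by omega⟩, m1, le_rfl⟩)
      · exact hsub (mem_compactDomain.2 ⟨⟨by omega, hij⟩, le_rfl, m2⟩)
  simpa [hτ₁] using key j' hj le_rfl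

/-- A hybrid time domain contained in `E` contains every point of `E` between two of its points. -/
theorem IsHybridTimeDomainFrom.mem_of_le (hS : IsHybridTimeDomainFrom t₀ j₀ S) (hSE : S ⊆ E)
    (hE : ∀ p ∈ E, ∀ q ∈ E, p.2 < q.2 → p.1 ≤ q.1) (hq : (t', j') ∈ S) (hp : (t, j) ∈ E)
    (ht₀ : t₀ ≤ t) (hj₀ : j₀ ≤ j) (ht : t ≤ t') (hj : j ≤ j') : (t, j) ∈ S := by
  obtain ⟨τ, hτ₀, hτ₁, hmono, htr⟩ := hS.truncation t' j' hq
  have hsub : ∀ {s i}, (s, i) ∈ compactDomain j₀ j' τ → (s, i) ∈ S := fun h =>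
    (htr.symm.subset h).1
  refine hsub (mem_compactDomain.2 ⟨⟨hj₀, hj⟩, ?_, ?_⟩)
  -- Endpoints of the neighbouring intervals of `S` lie in `E`, whose ordering then confines `t` to
  -- the `j`-th interval of `S`.
  · rcases hj₀.eq_or_lt with rfl | h
    · rwa [hτ₀]
    · obtain ⟨i, rfl⟩ : ∃ i, j = i + 1 := ⟨j - 1, by omega⟩
      refine hE (τ (i + 1), i) (hSE (hsub (mem_compactDomain.2 ⟨⟨by omega, by omega⟩, ?_, le_rfl⟩)))
        _ hp (Nat.lt_succ_self i)
      exact hmono i ⟨by omega, by omega⟩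
  · rcases hj.eq_or_lt with rfl | h
    · rwa [hτ₁]
    · refine hE _ hp (τ (j + 1), j + 1)
        (hSE (hsub (mem_compactDomain.2 ⟨⟨by omega, by omega⟩, le_rfl, ?_⟩))) (Nat.lt_succ_self j)
      exact hmono (j + 1) ⟨by omega, by omega⟩

theorem IsWindow.mem_of_mem_Icc (hW : IsWindow E t j K m τ) {s : ℝ} {i : ℕ} (hji : j ≤ i)
    (him : i ≤ m) (hs : s ∈ Set.Icc (τ i) (τ (i + 1))) :
    (s, i) ∈ E ∧ t ≤ s ∧ s ≤ τ (m + 1) := by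
  have h := hW.truncation.symm.subset (mem_compactDomain.2 ⟨⟨hji, him⟩, hs.1, hs.2⟩)
  exact ⟨h.1, h.2.1.1, h.2.1.2⟩

/-- A longer window could be shortened: drop the last jump if the last interval is a point,
otherwise trim that interval by at most 1/2. -/
theorem IsWindow.length_le (hW : IsWindow E t j K m τ) (hK : 0 < K) :
    τ (m + 1) - t + ((m : ℝ) - j) ≤ K + 1 := by
  by_contra! hlt
  have hm := hW.mono m ⟨hW.index_le, le_rfl⟩
  have hjm : (j : ℝ) ≤ m := by exact_mod_cast hW.index_le
  have ht := (hW.mem_of_mem_Icc hW.index_le le_rfl ⟨le_rfl, hm⟩).2.1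
  rcases hm.eq_or_lt with h | h
  · rcases hW.index_le.eq_or_lt with h' | h'
    · have := hW.start
      rw [h'] at this
      subst h'
      linarith
    · obtain ⟨i, rfl⟩ : ∃ i, m = i + 1 := ⟨m - 1, by omega⟩
      have h1 := hW.mem_of_mem_Icc (i := i) (by omega) (by omega)
        ⟨hW.mono i ⟨by omega, by omega⟩, le_rfl⟩
      have := hW.shortest _ _ h1.1 h1.2.1 (by omega) (by push_cast at hlt ⊢; linarith)
      push_cast at this
      linarith
  · set s := max (τ m) (τ (m + 1) - 1 / 2) with hs
    have hs1 : τ m ≤ s := le_max_left _ _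
    have hs2 : τ (m + 1) - 1 / 2 ≤ s := le_max_right _ _
    have hs3 : s < τ (m + 1) := max_lt h (by linarith)
    have h1 := hW.mem_of_mem_Icc (i := m) hW.index_le le_rfl ⟨hs1, hs3.le⟩
    have := hW.shortest _ _ h1.1 h1.2.1 hW.index_le (by linarith)
    linarith

/-- A window of `E` fits into a hybrid time domain `S ⊆ E` in which enough time is left. -/
theorem IsWindow.mem_of_long (hW : IsWindow E t j K m τ) (hS : IsHybridTimeDomainFrom t₀ j₀ S)
    (hSE : S ⊆ E) (hE : ∀ p ∈ E, ∀ q ∈ E, p.2 < q.2 → p.1 ≤ q.1) (hp : (t, j) ∈ S)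
    (hq : (t', j') ∈ S) (ht : t ≤ t') (hj : j ≤ j') (hK : K ≤ t' - t + ((j' : ℝ) - j)) :
    (∀ i s, j ≤ i → i ≤ m → s ∈ Set.Icc (τ i) (τ (i + 1)) → (s, i) ∈ S) ∧
      τ (m + 1) ≤ t' ∧ m ≤ j' := by
  have hend := (hW.mem_of_mem_Icc hW.index_le le_rfl
    ⟨hW.mono m ⟨hW.index_le, le_rfl⟩, le_rfl⟩).1
  have hshort := hW.shortest _ _ (hSE hq) ht hj hK
  -- Points of `E` are ordered consistently in time and index, so minimal length places the window's
  -- end before `(t', j')`.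
  have hle : τ (m + 1) ≤ t' ∧ m ≤ j' := by
    rcases lt_trichotomy m j' with h | h | h
    · exact ⟨hE _ hend _ (hSE hq) h, h.le⟩
    · subst h
      exact ⟨by linarith, le_rfl⟩
    · have h1 := hE _ (hSE hq) _ hend h
      have h2 : (j' : ℝ) + 1 ≤ m := by exact_mod_cast h
      simp only at h1
      linarith
  refine ⟨fun i s hji him hs => ?_, hle⟩
  obtain ⟨h1, h2, h3⟩ := hW.mem_of_mem_Icc hji him hs
  obtain ⟨h4, h5⟩ := hS.start_le _ hp
  exact hS.mem_of_le hSE hE hq h1 (h4.trans h2) (h5.trans hji) (h3.trans hle.1) (him.trans hle.2)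

end TimeDomain

/-- Telescoping along a hybrid time domain. -/
theorem sum_flow_add_sum_jump {j m : ℕ} (hjm : j ≤ m) (τ : ℕ → ℝ) (V : ℝ → ℕ → ℝ) :
    ∑ i ∈ Finset.Icc j m, (V (τ i) i - V (τ (i + 1)) i) +
      ∑ i ∈ Finset.Ico j m, (V (τ (i + 1)) i - V (τ (i + 1)) (i + 1)) =
        V (τ j) j - V (τ (m + 1)) m := by
  induction m, hjm using Nat.le_induction with
  | base => simp
  | succ m hm ih =>
    rw [Finset.sum_Icc_succ_top (by omega), Finset.sum_Ico_succ_top hm]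
    linarith

/-! ### Rank-one matrices and quadratic forms -/

section Matrices

variable {n : ℕ} {γ : ℝ} {ψ : ℝ → ℕ → EuclideanSpace ℝ (Fin n)}

theorem toEuclideanLin_smul_vecMulVec (c : ℝ) (p x : EuclideanSpace ℝ (Fin n)) :
    Matrix.toEuclideanLin (c • Matrix.vecMulVec p.ofLp p.ofLp) x = (c * inner ℝ p x) • p := by
  ext i
  simp [Matrix.toLpLin_apply, Matrix.vecMulVec_mulVec,
    EuclideanSpace.inner_eq_star_dotProduct, dotProduct_comm]
  ring

theorem dotProduct_smul_vecMulVec_mulVec (c : ℝ) (p x : EuclideanSpace ℝ (Fin n)) :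
    x.ofLp ⬝ᵥ (c • Matrix.vecMulVec p.ofLp p.ofLp).mulVec x.ofLp = c * inner ℝ p x ^ 2 := by
  rw [Matrix.smul_mulVec, Matrix.vecMulVec_mulVec, dotProduct_smul,
    EuclideanSpace.inner_eq_star_dotProduct, star_trivial, dotProduct_smul,
    dotProduct_comm p.ofLp x.ofLp]
  simp [pow_two]

/-- Turns the entrywise matrix integral into a scalar one; this needs `x` constant, hence the frozen
initial state. -/
theorem hybridIntegral_quadraticForm {j m : ℕ} {τ : ℕ → ℝ}
    {M : ℝ → ℕ → Matrix (Fin n) (Fin n) ℝ}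
    (hM : ∀ i ∈ Set.Icc j m, ∀ a b,
      IntervalIntegrable (fun s => M s i a b) volume (τ i) (τ (i + 1))) (x : Fin n → ℝ) :
    x ⬝ᵥ (Matrix.of fun a b => hybridIntegral j m τ fun s i => M s i a b).mulVec x =
      hybridIntegral j m τ fun s i => x ⬝ᵥ (M s i).mulVec x := by
  have h : ∀ i ∈ Finset.Icc j m, ∫ s in (τ i)..(τ (i + 1)), x ⬝ᵥ (M s i).mulVec x =
      ∑ a, ∑ b, x a * ((∫ s in (τ i)..(τ (i + 1)), M s i a b) * x b) := by
    intro i hi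
    have hi' : i ∈ Set.Icc j m := by simpa using hi
    simp only [dotProduct, Matrix.mulVec, Finset.mul_sum]
    rw [intervalIntegral.integral_finsetSum fun a _ => ?_]
    · refine Finset.sum_congr rfl fun a _ => ?_
      rw [intervalIntegral.integral_finsetSum fun b _ => ((hM i hi' a b).mul_const _).const_mul _]
      simp
    · simpa only [Finset.sum_fn] using
        IntervalIntegrable.sum _ fun b _ => ((hM i hi' a b).mul_const (x b)).const_mul (x a)
  unfold hybridIntegral
  rw [Finset.sum_congr rfl h]
  simp only [dotProduct, Matrix.mulVec, Matrix.of_apply, Finset.mul_sum, Finset.sum_mul, add_mul,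
    mul_add, Finset.sum_add_distrib]
  congr 1 <;>
  · rw [eq_comm, Finset.sum_comm]
    exact Finset.sum_congr rfl fun a _ => Finset.sum_comm

theorem intervalIntegrable_quadraticForm {M : ℝ → Matrix (Fin n) (Fin n) ℝ} {a b : ℝ}
    (hM : ∀ k l, IntervalIntegrable (fun s => M s k l) volume a b) (x : Fin n → ℝ) :
    IntervalIntegrable (fun s => x ⬝ᵥ (M s).mulVec x) volume a b := by
  simp only [dotProduct, Matrix.mulVec, Finset.mul_sum]
  simpa only [Finset.sum_fn] using IntervalIntegrable.sum _ fun k _ =>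
    IntervalIntegrable.sum _ fun l _ => ((hM k l).mul_const (x l)).const_mul (x k)

end Matrices

/-! ### Which matrix the excitation selects -/

section Excitation

variable {n : ℕ} {E : Set (ℝ × ℕ)} {A B : ℝ → ℕ → Matrix (Fin n) (Fin n) ℝ}

theorem Ioo_subset_interior_flowInterval {a b : ℝ} {j : ℕ}
    (h : ∀ s ∈ Set.Icc a b, (s, j) ∈ E) : Set.Ioo a b ⊆ interior (flowInterval E j) :=
  interior_maximal (fun s hs => h s (Set.Ioo_subset_Icc_self hs)) isOpen_Ioo

theorem excitation_of_mem_Ioo {a b t : ℝ} {j : ℕ} (h : ∀ s ∈ Set.Icc a b, (s, j) ∈ E)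
    (ht : t ∈ Set.Ioo a b) : excitation E A B t j = A t j :=
  if_pos (Ioo_subset_interior_flowInterval h ht)

/-- By ordering, no time with index `j` exceeds a jump time, so a jump time is never interior. -/
theorem excitation_of_jump {t : ℝ} {j : ℕ} (hE : ∀ p ∈ E, ∀ q ∈ E, p.2 < q.2 → p.1 ≤ q.1)
    (h : (t, j + 1) ∈ E) : excitation E A B t j = B t j := by
  refine if_neg fun ht => ?_
  have hsub : flowInterval E j ⊆ Set.Iic t := fun s hs => hE _ hs _ h (Nat.lt_succ_self j)
  have := interior_mono hsub ht
  rw [interior_Iic] at this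
  exact lt_irrefl t this

end Excitation

/-! ### Displacement and decrease along solutions -/

section Solutions

variable {n : ℕ} {E S : Set (ℝ × ℕ)} {γ α : ℝ} {ψ ζ : ℝ → ℕ → EuclideanSpace ℝ (Fin n)}
  {t₀ : ℝ} {j₀ : ℕ}

theorem IsSolution.isGradientFlow (hζ : IsSolution E (gradA γ ψ) (gradB γ ψ) t₀ j₀ S ζ) {i : ℕ}
    {a b : ℝ} (hab : a ≤ b) (h : ∀ s ∈ Set.Icc a b, (s, i) ∈ S) :
    IsGradientFlow γ (fun s => ψ s i) (fun s => ζ s i) a b where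
  le := hab
  ac := hζ.locallyAC i a (h a ⟨le_rfl, hab⟩) b (h b ⟨hab, le_rfl⟩)
  hasDerivAt := by
    filter_upwards [hζ.flow i] with t ht hm
    have := ht (Ioo_subset_interior_flowInterval h hm)
    rwa [gradA, toEuclideanLin_smul_vecMulVec] at this

theorem IsSolution.jump_eq (hζ : IsSolution E (gradA γ ψ) (gradB γ ψ) t₀ j₀ S ζ) {t : ℝ} {j : ℕ}
    (h : (t, j) ∈ S) (h' : (t, j + 1) ∈ S) :
    ζ t (j + 1) = ζ t j - (γ / (1 + γ * ‖ψ t j‖ ^ 2) * inner ℝ (ψ t j) (ζ t j)) • ψ t j := by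
  rw [hζ.jump t j h h', map_sub, gradB, LinearMap.sub_apply, toEuclideanLin_smul_vecMulVec]
  simp

theorem IsSolution.inner_sub_le (hζ : IsSolution E (gradA γ ψ) (gradB γ ψ) t₀ j₀ S ζ) (hγ : 0 < γ)
    (hψ : ∀ t j, (t, j) ∈ E → γ * ‖ψ t j‖ ^ 2 ≤ α) {t t' : ℝ} {j j' : ℕ} (hp : (t, j) ∈ S)
    (hq : (t', j') ∈ S) (ht : t ≤ t') (hj : j ≤ j') (w : EuclideanSpace ℝ (Fin n)) (c : ℝ) :
    2 * c * inner ℝ w (ζ t j - ζ t' j') ≤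
      c ^ 2 * ‖w‖ ^ 2 * (α * (t' - t) + ((j' : ℝ) - j)) + (‖ζ t j‖ ^ 2 - ‖ζ t' j'‖ ^ 2) := by
  have key := hζ.domain.le_of_antitone
    (G := fun s i => ‖ζ s i‖ ^ 2 - 2 * c * inner ℝ w (ζ s i) - c ^ 2 * ‖w‖ ^ 2 * (α * s + i))
    ?_ ?_ hp hq ht hj
  · simp only [inner_sub_right]
    linarith
  · intro i a b h hab
    have := (hζ.isGradientFlow hab h).inner_sub_le hγ.le
      (fun s hs => hψ s i (hζ.subset (h s (Set.Ioo_subset_Icc_self hs)))) w c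
    simp only [inner_sub_right] at this
    linarith
  · intro s i h h'
    have := jump_inner_sub_le (by positivity) (jumpGain_mul_sq_le hγ ‖ψ s i‖) (ζ s i) w c
    rw [← hζ.jump_eq h h'] at this
    simp only [inner_sub_right] at this
    push_cast
    linarith

theorem IsSolution.norm_sq_antitone (hζ : IsSolution E (gradA γ ψ) (gradB γ ψ) t₀ j₀ S ζ)
    (hγ : 0 < γ) (hψ : ∀ t j, (t, j) ∈ E → γ * ‖ψ t j‖ ^ 2 ≤ α) {t t' : ℝ} {j j' : ℕ}
    (hp : (t, j) ∈ S) (hq : (t', j') ∈ S) (ht : t ≤ t') (hj : j ≤ j') :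
    ‖ζ t' j'‖ ^ 2 ≤ ‖ζ t j‖ ^ 2 := by
  simpa using hζ.inner_sub_le hγ hψ hp hq ht hj 0 0

/-- The displacement of a solution is controlled by the decrease of its squared norm. -/
theorem IsSolution.norm_sub_sq_le (hζ : IsSolution E (gradA γ ψ) (gradB γ ψ) t₀ j₀ S ζ)
    (hγ : 0 < γ) (hψ : ∀ t j, (t, j) ∈ E → γ * ‖ψ t j‖ ^ 2 ≤ α) {t t' : ℝ} {j j' : ℕ}
    (hp : (t, j) ∈ S) (hq : (t', j') ∈ S) (ht : t ≤ t') (hj : j ≤ j') {q : ℝ} (hq0 : 0 < q)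
    (hle : α * (t' - t) + ((j' : ℝ) - j) ≤ q) :
    ‖ζ t j - ζ t' j'‖ ^ 2 ≤ q * (‖ζ t j‖ ^ 2 - ‖ζ t' j'‖ ^ 2) := by
  -- Testing against the displacement itself, with the optimal weight 1/q.
  have h := hζ.inner_sub_le hγ hψ hp hq ht hj (ζ t j - ζ t' j') q⁻¹
  rw [real_inner_self_eq_norm_sq] at h
  set W := ‖ζ t j - ζ t' j'‖ ^ 2
  have hW : 0 ≤ W := by positivity
  have h1 : q⁻¹ ^ 2 * W * (α * (t' - t) + ((j' : ℝ) - j)) ≤ q⁻¹ ^ 2 * W * q := by gcongr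
  have h2 : q⁻¹ ^ 2 * W * q = q⁻¹ * W := by field_simp
  have h3 : q⁻¹ * W ≤ ‖ζ t j‖ ^ 2 - ‖ζ t' j'‖ ^ 2 := by linarith
  rwa [inv_mul_le_iff₀ hq0] at h3

/-- Persistency of excitation on a window forces a proportional decrease of the squared norm. -/
theorem IsSolution.excitation_le_decrease
    (hζ : IsSolution E (gradA γ ψ) (gradB γ ψ) t₀ j₀ S ζ)
    (hE : ∀ p ∈ E, ∀ q ∈ E, p.2 < q.2 → p.1 ≤ q.1) (hγ : 0 < γ) (hα : 0 < α)
    (hψ : ∀ t j, (t, j) ∈ E → γ * ‖ψ t j‖ ^ 2 ≤ α) {t K μ : ℝ} {j m : ℕ} {τ : ℕ → ℝ}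
    (hK : 0 < K) (hW : IsWindow E t j K m τ)
    (hWS : ∀ i s, j ≤ i → i ≤ m → s ∈ Set.Icc (τ i) (τ (i + 1)) → (s, i) ∈ S)
    (hint : ∀ i ∈ Set.Icc j m, ∀ a b, IntervalIntegrable
      (fun s => excitation E (gradA γ ψ) (gradB γ ψ) s i a b) volume (τ i) (τ (i + 1)))
    (hpos : (Matrix.of (fun a b => hybridIntegral j m τ
        (fun s i => excitation E (gradA γ ψ) (gradB γ ψ) s i a b))
      - μ • (1 : Matrix (Fin n) (Fin n) ℝ)).PosSemidef) :
    μ * ‖ζ t j‖ ^ 2 ≤ (1 + (α * (τ (m + 1) - t) + ((m : ℝ) - j))) ^ 2 *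
      (‖ζ t j‖ ^ 2 - ‖ζ (τ (m + 1)) m‖ ^ 2) := by
  have hend : τ (m + 1) ∈ Set.Icc (τ m) (τ (m + 1)) := ⟨hW.mono m ⟨hW.index_le, le_rfl⟩, le_rfl⟩
  have hendS := hWS m _ hW.index_le le_rfl hend
  have hstart : τ j ∈ Set.Icc (τ j) (τ (j + 1)) := ⟨le_rfl, hW.mono j ⟨le_rfl, hW.index_le⟩⟩
  have hstartS := hWS j _ le_rfl hW.index_le hstart
  rw [hW.start] at hstartS
  have hjm : (j : ℝ) ≤ m := by exact_mod_cast hW.index_le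
  have htle : t ≤ τ (m + 1) := (hW.mem_of_mem_Icc hW.index_le le_rfl hend).2.1
  set q := α * (τ (m + 1) - t) + ((m : ℝ) - j) with hq
  set D := ‖ζ t j‖ ^ 2 - ‖ζ (τ (m + 1)) m‖ ^ 2 with hD
  -- A window has length at least K > 0, so without elapsed time it contains a jump.
  have hq0 : 0 < q := by
    have hlong := hW.long
    rcases htle.eq_or_lt with h | h
    · rw [← h, sub_self] at hlong
      have := mul_nonneg hα.le (sub_nonneg.2 htle)
      linarith
    · have := mul_pos hα (sub_pos.2 h)
      linarith
  have hdisp : ∀ i s, j ≤ i → i ≤ m → s ∈ Set.Icc (τ i) (τ (i + 1)) →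
      ‖ζ t j - ζ s i‖ ^ 2 ≤ q * D := by
    intro i s hji him hs
    obtain ⟨-, h1, h2⟩ := hW.mem_of_mem_Icc hji him hs
    have hsS := hWS i s hji him hs
    have him' : (i : ℝ) ≤ m := by exact_mod_cast him
    have h3 := hζ.norm_sub_sq_le hγ hψ hstartS hsS h1 hji hq0 (by
      have := mul_le_mul_of_nonneg_left h2 hα.le
      rw [hq]
      linarith)
    refine h3.trans (mul_le_mul_of_nonneg_left ?_ hq0.le)
    have := hζ.norm_sq_antitone hγ hψ hsS hendS h2 him
    rw [hD]
    linarith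
  have hquad : μ * ‖ζ t j‖ ^ 2 ≤ hybridIntegral j m τ fun s i =>
      (ζ t j).ofLp ⬝ᵥ (excitation E (gradA γ ψ) (gradB γ ψ) s i).mulVec (ζ t j).ofLp := by
    rw [← hybridIntegral_quadraticForm hint]
    have h := hpos.dotProduct_mulVec_nonneg (ζ t j).ofLp
    rw [Matrix.sub_mulVec, Matrix.smul_mulVec, Matrix.one_mulVec, dotProduct_sub,
      dotProduct_smul, star_trivial] at h
    have h' : (ζ t j).ofLp ⬝ᵥ (ζ t j).ofLp = ‖ζ t j‖ ^ 2 := by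
      rw [← real_inner_self_eq_norm_sq, EuclideanSpace.inner_eq_star_dotProduct, star_trivial]
    rw [h', smul_eq_mul] at h
    linarith
  have hflow : ∀ i ∈ Finset.Icc j m, (∫ s in (τ i)..(τ (i + 1)),
      (ζ t j).ofLp ⬝ᵥ (excitation E (gradA γ ψ) (gradB γ ψ) s i).mulVec (ζ t j).ofLp) ≤
      (1 + q) * ((‖ζ (τ i) i‖ ^ 2 - ‖ζ (τ (i + 1)) i‖ ^ 2) + α * D * (τ (i + 1) - τ i)) := by
    intro i hi
    obtain ⟨hji, him⟩ := Finset.mem_Icc.1 hi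
    have hS : ∀ s ∈ Set.Icc (τ i) (τ (i + 1)), (s, i) ∈ S := fun s hs => hWS i s hji him hs
    refine (hζ.isGradientFlow (hW.mono i ⟨hji, him⟩) hS).integral_inner_sq_le hγ.le hq0 hα.le
      (fun s hs => hψ s i (hζ.subset (hS s (Set.Ioo_subset_Icc_self hs))))
      (fun s hs => hdisp i s hji him (Set.Ioo_subset_Icc_self hs)) (fun s hs => ?_)
      (intervalIntegrable_quadraticForm (hint i ⟨hji, him⟩) _)
    rw [excitation_of_mem_Ioo (fun r hr => hζ.subset (hS r hr)) hs, gradA,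
      dotProduct_smul_vecMulVec_mulVec]
  have hjump : ∀ i ∈ Finset.Ico j m, (ζ t j).ofLp ⬝ᵥ
      (excitation E (gradA γ ψ) (gradB γ ψ) (τ (i + 1)) i).mulVec (ζ t j).ofLp ≤
      (1 + q) * ((‖ζ (τ (i + 1)) i‖ ^ 2 - ‖ζ (τ (i + 1)) (i + 1)‖ ^ 2) + D) := by
    intro i hi
    obtain ⟨hji, him⟩ := Finset.mem_Ico.1 hi
    have hm1 : τ (i + 1) ∈ Set.Icc (τ i) (τ (i + 1)) := ⟨hW.mono i ⟨hji, him.le⟩, le_rfl⟩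
    have h1 := hWS i _ hji him.le hm1
    have h2 : (τ (i + 1), i + 1) ∈ S :=
      hWS (i + 1) _ (by omega) him ⟨le_rfl, hW.mono (i + 1) ⟨by omega, him⟩⟩
    rw [excitation_of_jump hE (hζ.subset h2), gradB, dotProduct_smul_vecMulVec_mulVec]
    have hb : 0 ≤ γ / (1 + γ * ‖ψ (τ (i + 1)) i‖ ^ 2) := by positivity
    have hb1 := jumpGain_mul_sq_le hγ ‖ψ (τ (i + 1)) i‖
    have h3 := mul_inner_sq_le_split hb hq0 zero_le_one hb1 (hdisp i _ hji him.le hm1)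
    have h4 := jump_norm_sq_le hb hb1 (ζ (τ (i + 1)) i)
    rw [← hζ.jump_eq h1 h2] at h4
    refine h3.trans (mul_le_mul_of_nonneg_left ?_ (by linarith))
    linarith
  have htel := sum_flow_add_sum_jump hW.index_le τ fun s i => ‖ζ s i‖ ^ 2
  -- Telescoping time itself: the flow durations add up to the elapsed time, since jumps are
  -- instantaneous.
  have htel' := sum_flow_add_sum_jump hW.index_le τ fun s _ => s
  rw [hW.start] at htel htel'
  simp only [sub_self, Finset.sum_const_zero, add_zero] at htel'
  calc μ * ‖ζ t j‖ ^ 2 ≤ _ := hquad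
    _ ≤ ∑ i ∈ Finset.Icc j m, (1 + q) *
          ((‖ζ (τ i) i‖ ^ 2 - ‖ζ (τ (i + 1)) i‖ ^ 2) + α * D * (τ (i + 1) - τ i)) +
        ∑ i ∈ Finset.Ico j m, (1 + q) *
          ((‖ζ (τ (i + 1)) i‖ ^ 2 - ‖ζ (τ (i + 1)) (i + 1)‖ ^ 2) + D) :=
      add_le_add (Finset.sum_le_sum hflow) (Finset.sum_le_sum hjump)
    _ = (1 + q) * (D + α * D * (τ (m + 1) - t) + ((m : ℝ) - j) * D) := by
      have hneg : ∑ i ∈ Finset.Icc j m, (τ (i + 1) - τ i) = τ (m + 1) - t := by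
        rw [← neg_inj, ← Finset.sum_neg_distrib]
        simpa using htel'
      rw [← Finset.mul_sum, ← Finset.mul_sum, Finset.sum_add_distrib, Finset.sum_add_distrib,
        ← Finset.mul_sum, hneg, Finset.sum_const, Nat.card_Ico, nsmul_eq_mul,
        Nat.cast_sub hW.index_le, hD, ← htel]
      ring
    _ = (1 + q) ^ 2 * D := by
      rw [hq]
      ring

end Solutions

/-! ### The explicit constants -/

section Constants

variable {a μ K : ℝ}

theorem rhoConst_pos (ha : 0 < a) (hK : 0 < K) : 0 < rhoConst a K := by
  unfold rhoConst
  positivity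

theorem muConst_pos (ha : 0 < a) (hμ : 0 < μ) (hK : 0 < K) : 0 < muConst a μ K := by
  have := rhoConst_pos ha hK
  unfold muConst
  positivity

theorem one_le_cSqConst (ha : 0 < a) (hμ : 0 < μ) (hK : 0 < K) : 1 ≤ cSqConst a μ K := by
  have := muConst_pos ha hμ hK
  have h : 0 ≤ 1 / muConst a μ K := by positivity
  unfold cSqConst
  nlinarith [mul_nonneg hK.le h]

theorem muConst_mul_sq_le (ha : 0 < a) (hμ : 0 < μ) (hK : 0 < K) {T N : ℝ} (hT : 0 ≤ T)
    (hN : 0 ≤ N) (hTN : T + N ≤ K + 1) : muConst a μ K * (1 + (a * T + N)) ^ 2 ≤ μ := by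
  set R := (K + 2) ^ 2 * (a / 2 * (K + 1) + 1 + a * (a + 2) * (K + 1) * (K + 2)) with hR
  have hR0 : 0 < R := by positivity
  -- Since ρ = 1/R, what remains is (1 + aT + N)² ≤ 1 + R, which holds with room to spare.
  have hmu : muConst a μ K = μ / (1 + R) := by
    unfold muConst rhoConst
    rw [← hR]
    field_simp
    ring
  have h1 : (1 + (a * T + N)) ^ 2 ≤ 1 + R := by
    have hT' : T ≤ K + 1 := by linarith
    have h2 : a * T + N ≤ (K + 1) + a * (K + 1) := by nlinarith
    have h3 : (1 + (a * T + N)) ^ 2 ≤ (1 + ((K + 1) + a * (K + 1))) ^ 2 := by gcongr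
    refine h3.trans ?_
    have h4 : (K + 2) ^ 2 + (a ^ 2 + 2 * a) * (K + 1) * (K + 2) ≤ R := by
      have h5 : 1 ≤ (K + 2) ^ 2 := by nlinarith
      have h6 : 0 ≤ a / 2 * (K + 1) := by positivity
      have h7 : 0 ≤ a * (a + 2) * (K + 1) * (K + 2) := by positivity
      rw [hR]
      nlinarith [mul_nonneg (sub_nonneg.2 h5) h7, mul_nonneg (sq_nonneg (K + 2)) h6]
    have h8 : 0 ≤ a ^ 2 * (K + 1) := by positivity
    nlinarith
  rw [hmu, div_mul_eq_mul_div, div_le_iff₀ (by positivity)]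
  exact mul_le_mul_of_nonneg_left h1 hμ.le

end Constants

/-! ### Chaining windows into exponential decay -/

section Decay

variable {n : ℕ} {E S : Set (ℝ × ℕ)} {γ α μ K : ℝ} {ψ ζ : ℝ → ℕ → EuclideanSpace ℝ (Fin n)}
  {t₀ : ℝ} {j₀ : ℕ}

/-- Over one window the squared norm shrinks by the factor `1 - μ₀`. -/
theorem IsSolution.exists_decrease (hζ : IsSolution E (gradA γ ψ) (gradB γ ψ) t₀ j₀ S ζ)
    (hE : ∀ p ∈ E, ∀ q ∈ E, p.2 < q.2 → p.1 ≤ q.1) (hγ : 0 < γ) (hα : 0 < α)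
    (hψ : ∀ t j, (t, j) ∈ E → γ * ‖ψ t j‖ ^ 2 ≤ α)
    (hHPE : IsHPEWith E (gradA γ ψ) (gradB γ ψ) K μ) {t t' : ℝ} {j j' : ℕ} (hp : (t, j) ∈ S)
    (hq : (t', j') ∈ S) (ht : t ≤ t') (hj : j ≤ j') (hlong : K ≤ t' - t + ((j' : ℝ) - j)) :
    ∃ s i, (s, i) ∈ S ∧ s ≤ t' ∧ i ≤ j' ∧ K ≤ s - t + ((i : ℝ) - j) ∧
      s - t + ((i : ℝ) - j) ≤ K + 1 ∧ ‖ζ s i‖ ^ 2 ≤ (1 - muConst α μ K) * ‖ζ t j‖ ^ 2 := by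
  obtain ⟨hK, hμ, hwin⟩ := hHPE
  obtain ⟨m, τ, hW, hint, hpos⟩ := hwin t j (hζ.subset hp)
  obtain ⟨hWS, hle, hmj⟩ := hW.mem_of_long hζ.domain hζ.subset hE hp hq ht hj hlong
  have hend : τ (m + 1) ∈ Set.Icc (τ m) (τ (m + 1)) := ⟨hW.mono m ⟨hW.index_le, le_rfl⟩, le_rfl⟩
  have hlen := hW.length_le hK
  refine ⟨τ (m + 1), m, hWS m _ hW.index_le le_rfl hend, hle, hmj, hW.long, hlen, ?_⟩
  have hjm : (j : ℝ) ≤ m := by exact_mod_cast hW.index_le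
  have htle : t ≤ τ (m + 1) := (hW.mem_of_mem_Icc hW.index_le le_rfl hend).2.1
  have h1 := hζ.excitation_le_decrease hE hγ hα hψ hK hW hWS hint hpos
  have h2 := muConst_mul_sq_le (K := K) hα hμ hK (sub_nonneg.2 htle) (sub_nonneg.2 hjm) hlen
  set Q := (1 + (α * (τ (m + 1) - t) + ((m : ℝ) - j))) ^ 2 with hQ
  have hQ0 : 0 < Q := by
    have h3 := mul_nonneg hα.le (sub_nonneg.2 htle)
    have h4 := sub_nonneg.2 hjm
    positivity
  have h3 : Q * (muConst α μ K * ‖ζ t j‖ ^ 2) ≤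
      Q * (‖ζ t j‖ ^ 2 - ‖ζ (τ (m + 1)) m‖ ^ 2) := by
    refine le_trans ?_ h1
    have := mul_le_mul_of_nonneg_right h2 (sq_nonneg ‖ζ t j‖)
    linarith
  have := le_of_mul_le_mul_left h3 hQ0
  linarith

/-- Each window contributes a factor at most e^{-η} and has length at most K + 1; the extra e^{η}
pays for an incomplete last window. The induction restarts at the end of a window, which uses up at
least K of the remaining length. -/
theorem IsSolution.norm_sq_le_exp (hζ : IsSolution E (gradA γ ψ) (gradB γ ψ) t₀ j₀ S ζ)
    (hE : ∀ p ∈ E, ∀ q ∈ E, p.2 < q.2 → p.1 ≤ q.1) (hγ : 0 < γ) (hα : 0 < α)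
    (hψ : ∀ t j, (t, j) ∈ E → γ * ‖ψ t j‖ ^ 2 ≤ α)
    (hHPE : IsHPEWith E (gradA γ ψ) (gradB γ ψ) K μ) {η : ℝ} (hη : 0 ≤ η)
    (hημ : η ≤ muConst α μ K) (N : ℕ) :
    ∀ {t t' : ℝ} {j j' : ℕ}, (t, j) ∈ S → (t', j') ∈ S → t ≤ t' → j ≤ j' →
      t' - t + ((j' : ℝ) - j) ≤ N * K →
      ‖ζ t' j'‖ ^ 2 ≤
        Real.exp (η - η * ((t' - t + ((j' : ℝ) - j)) / (K + 1))) * ‖ζ t j‖ ^ 2 := by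
  have hK : 0 < K := hHPE.1
  have hshort : ∀ {t t' : ℝ} {j j' : ℕ}, (t, j) ∈ S → (t', j') ∈ S → t ≤ t' → j ≤ j' →
      t' - t + ((j' : ℝ) - j) ≤ K →
      ‖ζ t' j'‖ ^ 2 ≤
        Real.exp (η - η * ((t' - t + ((j' : ℝ) - j)) / (K + 1))) * ‖ζ t j‖ ^ 2 := by
    intro t t' j j' hp hq ht hj hle
    refine (hζ.norm_sq_antitone hγ hψ hp hq ht hj).trans ?_
    refine le_mul_of_one_le_left (sq_nonneg _) (Real.one_le_exp ?_)
    have h1 : (t' - t + ((j' : ℝ) - j)) / (K + 1) ≤ 1 := by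
      rw [div_le_one (by linarith)]
      linarith
    have := mul_le_mul_of_nonneg_left h1 hη
    linarith
  induction N with
  | zero =>
    intro t t' j j' hp hq ht hj hle
    refine hshort hp hq ht hj (hle.trans ?_)
    simpa using hK.le
  | succ N ih =>
    intro t t' j j' hp hq ht hj hle
    rcases le_total (t' - t + ((j' : ℝ) - j)) K with h | h
    · exact hshort hp hq ht hj h
    obtain ⟨s, i, hs, hst, hij, h1, h2, h3⟩ :=
      hζ.exists_decrease hE hγ hα hψ hHPE hp hq ht hj h
    have h4 := ih hs hq hst hij (by push_cast at hle; linarith)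
    have h5 : 1 - muConst α μ K ≤ Real.exp (-η) :=
      le_trans (by linarith) (Real.one_sub_le_exp_neg η)
    calc ‖ζ t' j'‖ ^ 2 ≤ _ := h4
      _ ≤ Real.exp (η - η * ((t' - s + ((j' : ℝ) - i)) / (K + 1))) *
          (Real.exp (-η) * ‖ζ t j‖ ^ 2) := by
        refine mul_le_mul_of_nonneg_left (h3.trans ?_) (Real.exp_pos _).le
        exact mul_le_mul_of_nonneg_right h5 (sq_nonneg _)
      _ = Real.exp (η - η * ((t' - s + ((j' : ℝ) - i)) / (K + 1)) + -η) * ‖ζ t j‖ ^ 2 := by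
        rw [Real.exp_add, mul_assoc]
      _ ≤ _ := by
        refine mul_le_mul_of_nonneg_right (Real.exp_le_exp.2 ?_) (sq_nonneg _)
        have h6 : (t' - t + ((j' : ℝ) - j)) / (K + 1) ≤
            (t' - s + ((j' : ℝ) - i)) / (K + 1) + 1 := by
          rw [div_add_one (by linarith)]
          exact div_le_div_of_nonneg_right (by linarith) (by linarith)
        have := mul_le_mul_of_nonneg_left h6 hη
        linarith

end Decay

theorem isUESWith_kappa_rate {n : ℕ} {E : Set (ℝ × ℕ)} (hE : IsHybridTimeDomain E)
    {γ : ℝ} (hγ : 0 < γ) {ψ : ℝ → ℕ → EuclideanSpace ℝ (Fin n)} {ψbar : ℝ} (hψbar : 0 < ψbar)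
    (hψ : ∀ t j, (t, j) ∈ E → ‖ψ t j‖ ≤ ψbar) {K μ : ℝ}
    (hHPE : IsHPEWith E (gradA γ ψ) (gradB γ ψ) K μ) :
    IsUESWith E (gradA γ ψ) (gradB γ ψ) (kappa γ ψbar μ K) (rate γ ψbar μ K) := by
  have hK := hHPE.1
  have hμ := hHPE.2.1
  set α := γ * ψbar ^ 2 with hα
  have hα0 : 0 < α := by positivity
  have hψ' : ∀ t j, (t, j) ∈ E → γ * ‖ψ t j‖ ^ 2 ≤ α := fun t j h => by
    have := hψ t j h
    rw [hα]
    gcongr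
  have hμ0 := muConst_pos hα0 hμ hK
  have hc := one_le_cSqConst hα0 hμ hK
  have hc0 : 0 < cSqConst α μ K := by linarith
  have hκ : 0 < kappa γ ψbar μ K := mul_pos (Real.sqrt_pos.2 hc0) (Real.exp_pos _)
  refine ⟨hκ, by unfold rate; positivity, fun t₀ j₀ _ S ζ hζ t j htj => ?_⟩
  obtain ⟨ht, hj⟩ := hζ.domain.start_le _ htj
  set ν := muConst α μ K with hν
  -- Chosen so that η/(K + 1) = 1/c², twice the claimed rate.
  set η := ν / (1 + ν) with hη
  have hη0 : 0 ≤ η := by positivity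
  have hη1 : η ≤ 1 := by
    rw [hη, div_le_one (by positivity)]
    linarith
  have hην : η ≤ ν := div_le_self hμ0.le (by linarith)
  obtain ⟨N, hN⟩ := exists_nat_ge ((t - t₀ + ((j : ℝ) - j₀)) / K)
  rw [div_le_iff₀ hK] at hN
  have key := hζ.norm_sq_le_exp hE.ordered hγ hα0 hψ' hHPE hη0 hην N hζ.domain.start_mem htj
    ht hj hN
  have hrate : η * ((t - t₀ + ((j : ℝ) - j₀)) / (K + 1)) =
      2 * (rate γ ψbar μ K * (t + (j : ℝ) - t₀ - (j₀ : ℝ))) := by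
    rw [rate, cSqConst, ← hα, ← hν, hη]
    field_simp
    ring
  refine (sq_le_sq₀ (norm_nonneg _) (by positivity)).1 ?_
  have hsq : (kappa γ ψbar μ K * ‖ζ t₀ j₀‖ *
      Real.exp (-rate γ ψbar μ K * (t + (j : ℝ) - t₀ - (j₀ : ℝ)))) ^ 2 =
      cSqConst α μ K * Real.exp (1 - η * ((t - t₀ + ((j : ℝ) - j₀)) / (K + 1))) *
        ‖ζ t₀ j₀‖ ^ 2 := by
    have hexp : ∀ r : ℝ, Real.exp (1 - 2 * r) = Real.exp (1 / 2) ^ 2 * Real.exp (-r) ^ 2 := by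
      intro r
      rw [← Real.exp_nat_mul, ← Real.exp_nat_mul, ← Real.exp_add]
      push_cast
      ring_nf
    rw [kappa, mul_pow, mul_pow, mul_pow, Real.sq_sqrt hc0.le, hrate, hexp, neg_mul]
    ring
  rw [hsq]
  refine key.trans (mul_le_mul_of_nonneg_right ?_ (sq_nonneg _))
  -- The estimate already holds with e^{η} ≤ e in place of κ² = c²e; the factor c² ≥ 1 is slack.
  refine (Real.exp_le_exp.2 ?_).trans (le_mul_of_one_le_left (Real.exp_pos _).le hc)
  linarith

end HybridGradient

theorem mainTheorem6 {n : ℕ} (E : Set (ℝ × ℕ)) (hE : HybridGradient.IsHybridTimeDomain E)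
    (γ : ℝ) (hγ : 0 < γ) (ψ : ℝ → ℕ → EuclideanSpace ℝ (Fin n))
    (ψbar : ℝ) (hψbar : 0 < ψbar) (hψ : ∀ t j, (t, j) ∈ E → ‖ψ t j‖ ≤ ψbar)
    (K μ : ℝ)
    (hHPE : HybridGradient.IsHPEWith E (HybridGradient.gradA γ ψ) (HybridGradient.gradB γ ψ) K μ) :
    HybridGradient.IsUES E (HybridGradient.gradA γ ψ) (HybridGradient.gradB γ ψ) ∧
    HybridGradient.IsUESWith E (HybridGradient.gradA γ ψ) (HybridGradient.gradB γ ψ)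
      (HybridGradient.kappa γ ψbar μ K) (HybridGradient.rate γ ψbar μ K) :=
  have h := HybridGradient.isUESWith_kappa_rate hE hγ hψbar hψ hHPE
  ⟨⟨_, _, h⟩, h⟩
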